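/- Let $G=(G_1,\dots,G_n)$ be a collection of $n$ (not necessarily distinct) simple graphs on a common vertex set $V$ with $|V|=n$. For a simple graph $H$ on $V$, let $\sigma_2(H)=\min\{d_H(x)+d_H(y) : x,y\in V,\ x\neq y,\ xy\notin E(H)\}$, with $\sigma_2(H)=\infty$ if $H$ is complete. For a graph $H$ with vertices in $V$, say that $G$ contains a rainbow $H$ if there is an injection $c:E(H)\to\{1,\dots,n\}$ such that $e\in E(G_{c(e)})$ for every $e\in E(H)$. Suppose that $\sigma_2(G_i)\ge n$ for every $i\in\{1,\dots,n\}$. Then at least one of the following holds: (1) $G$ contains a rainbow Hamiltonian cycle, that is, a rainbow $C$ for some cycle $C$ with $V(C)=V$; (2) $G$ is rainbow Hamiltonian-connected, that is, for every pair of distinct vertices $u,v\in V$, $G$ contains a rainbow $P$ for some path $P$ from $u$ to $v$ with $V(P)=V$. -/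

import Mathlib

namespace RainbowHam

/-- `σ₂(H)`: the minimum of `d_H(u) + d_H(v)` over all pairs of distinct non-adjacent vertices.
The value lies in `ℕ∞`, and is `⊤` (minimum over the empty set) if there is no such pair. -/
noncomputable def sigma2 {V : Type*} [Fintype V] (H : SimpleGraph V) [DecidableRel H.Adj] : ℕ∞ :=
  ⨅ (u : V) (v : V) (_ : u ≠ v) (_ : ¬ H.Adj u v), ((H.degree u + H.degree v : ℕ) : ℕ∞)

/-- The collection `G`, indexed by a set `ι` of colors, contains a rainbow `H`, where `H` is a graph
with vertices in `V` (a subgraph of the complete graph on `V`): there is an injective assignment `c`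
of colors to the edges of `H` such that each edge `e` of `H` is an edge of `G (c e)`. -/
def ContainsRainbow {V ι : Type*} (G : ι → SimpleGraph V)
    (H : (⊤ : SimpleGraph V).Subgraph) : Prop :=
  ∃ c : H.edgeSet → ι, Function.Injective c ∧ ∀ e : H.edgeSet, (e : Sym2 V) ∈ (G (c e)).edgeSet

/-- `G` has a rainbow Hamiltonian cycle. -/
def HasRainbowHamiltonianCycle {V ι : Type*} [DecidableEq V] (G : ι → SimpleGraph V) : Prop :=
  ∃ (w : V) (p : (⊤ : SimpleGraph V).Walk w w),
    p.IsHamiltonianCycle ∧ ContainsRainbow G p.toSubgraph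

/-- `G` has a rainbow Hamiltonian path from `u` to `v`. -/
def HasRainbowHamiltonianPath {V ι : Type*} [DecidableEq V] (G : ι → SimpleGraph V)
    (u v : V) : Prop :=
  ∃ p : (⊤ : SimpleGraph V).Walk u v, p.IsHamiltonian ∧ ContainsRainbow G p.toSubgraph

/-- `G` is rainbow Hamiltonian-connected. -/
def RainbowHamiltonianConnected {V ι : Type*} [DecidableEq V] (G : ι → SimpleGraph V) : Prop :=
  ∀ u v : V, u ≠ v → HasRainbowHamiltonianPath G u v

end RainbowHam

/-! Suppose there is no rainbow Hamiltonian cycle, and let u ≠ v. Add uv to every graph. A family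
satisfying Ore's condition with a common edge does have a rainbow Hamiltonian cycle
(`hasRainbowClosedPath_of_common_edge`). That cycle must use uv, and deleting uv leaves a rainbow
Hamiltonian path from u to v in the original family.

The common-edge statement is an Ore-type closure argument. In a maximal counterexample, some graph i
misses a pair xy with x on a common edge xz. Adding xy to graph i creates a rainbow cycle, hence a
rainbow Hamiltonian path from x to y avoiding color i. Rotating this path along xz gives a path from
some w to y in which xz can take any color, so two colors are spare. Ore's condition for w, y in
both spare colors then forces a crossing that closes a cycle (`hasRainbowClosedPath_of_path`). -/

namespace RainbowHam

open SimpleGraph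

/-! ### Rainbow colorings of edge multisets -/

section Coloring

variable {V ι : Type*}

/-- The multiset `E` of edges can be colored with pairwise distinct colors, each edge lying in the
graph of its color. -/
def IsRainbow (G : ι → SimpleGraph V) (E : Multiset (Sym2 V)) : Prop :=
  ∃ M : Multiset (Sym2 V × ι), M.map Prod.fst = E ∧ (M.map Prod.snd).Nodup ∧
    ∀ t ∈ M, t.1 ∈ (G t.2).edgeSet

theorem IsRainbow.containsRainbow {G : ι → SimpleGraph V} {H : (⊤ : SimpleGraph V).Subgraph}
    {E : Multiset (Sym2 V)} (h : IsRainbow G E) (hE : ∀ e ∈ H.edgeSet, e ∈ E) :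
    ContainsRainbow G H := by
  obtain ⟨M, rfl, hnd, hM⟩ := h
  have key : ∀ e : H.edgeSet, ∃ k, ((e : Sym2 V), k) ∈ M := by
    intro e
    simpa using hE e e.2
  choose c hc using key
  refine ⟨c, fun e f hef ↦ ?_, fun e ↦ hM _ (hc e)⟩
  have := Multiset.inj_on_of_nodup_map hnd _ (hc e) _ (hc f) hef
  exact Subtype.ext (congrArg Prod.fst this)

theorem isRainbow_of_forall_adj {n : ℕ} {G : Fin n → SimpleGraph V}
    (hG : ∀ i x y, x ≠ y → (G i).Adj x y) {E : List (Sym2 V)} (hE : E.length = n)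
    (hd : ∀ e ∈ E, ¬ e.IsDiag) : IsRainbow G (E : Multiset (Sym2 V)) := by
  have hl : E.length = (List.finRange n).length := by simp [hE]
  refine ⟨(E.zip (List.finRange n) : List _), ?_, ?_, ?_⟩
  · rw [Multiset.map_coe, List.map_fst_zip hl.le]
  · rw [Multiset.map_coe, List.map_snd_zip hl.ge]
    exact List.nodup_finRange n
  · rintro ⟨e, i⟩ ht
    have he : e ∈ E := (List.of_mem_zip (by simpa using ht)).1
    have := hd e he
    induction e with
    | h x y => exact hG i x y (by simpa using this)

end Coloring

/-! ### Splitting and reopening Hamiltonian paths -/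

section Walks

variable {V : Type*} {H : SimpleGraph V}

theorem exists_eq_append_of_mem_darts {x y : V} (p : H.Walk x y) {d : H.Dart} (hd : d ∈ p.darts) :
    ∃ (q₁ : H.Walk x d.fst) (q₂ : H.Walk d.snd y), p = q₁.append (.cons d.adj q₂) := by
  induction p with
  | nil => simp at hd
  | cons h p ih =>
    rw [Walk.darts_cons, List.mem_cons] at hd
    rcases hd with rfl | hd
    · exact ⟨.nil, p, rfl⟩
    · obtain ⟨q₁, q₂, rfl⟩ := ih hd
      exact ⟨.cons h q₁, q₂, rfl⟩

theorem exists_dart_snd_eq {x y z : V} (p : H.Walk x y) (hz : z ∈ p.support) (hzx : z ≠ x) :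
    ∃ d ∈ p.darts, d.snd = z := by
  have : z ∈ p.support.tail := by
    rw [← p.cons_tail_support, List.mem_cons] at hz
    exact hz.resolve_left hzx
  simpa [← p.map_snd_darts] using this

theorem exists_dart_fst_eq {x y z : V} (p : H.Walk x y) (hz : z ∈ p.support) (hzy : z ≠ y) :
    ∃ d ∈ p.darts, d.fst = z := by
  rw [← p.map_fst_darts_append] at hz
  simpa [hzy] using hz

variable [DecidableEq V]

theorem isHamiltonian_of_perm {x y x' y' : V} {p : H.Walk x y} {q : H.Walk x' y'}
    (hp : p.IsHamiltonian) (h : q.support.Perm p.support) : q.IsHamiltonian :=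
  fun a ↦ (h.count_eq a).trans (hp a)

/-- A Hamiltonian path of the complete graph, seen as a Hamiltonian cycle together with the closing
edge `s(y, x)`, can be reopened at any edge of that cycle. -/
theorem exists_hamiltonian_reopen {x y a b : V} {p : (⊤ : SimpleGraph V).Walk x y}
    (hp : p.IsHamiltonian) (hxy : x ≠ y)
    (he : s(a, b) ∈ (s(y, x) ::ₘ (p.edges : Multiset (Sym2 V)))) :
    ∃ q : (⊤ : SimpleGraph V).Walk a b, q.IsHamiltonian ∧
      s(a, b) ::ₘ (q.edges : Multiset (Sym2 V)) = s(y, x) ::ₘ (p.edges : Multiset (Sym2 V)) := by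
  suffices h : ∃ q : (⊤ : SimpleGraph V).Walk a b, q.IsHamiltonian ∧
      (s(a, b) :: q.edges).Perm (s(y, x) :: p.edges) by
    obtain ⟨q, hq, hperm⟩ := h
    exact ⟨q, hq, by simpa using Multiset.coe_eq_coe.2 hperm⟩
  have reverse_case : ∀ {a b : V} (q : (⊤ : SimpleGraph V).Walk a b), q.IsHamiltonian →
      (s(a, b) :: q.edges).Perm (s(y, x) :: p.edges) →
      ∃ q : (⊤ : SimpleGraph V).Walk b a, q.IsHamiltonian ∧
        (s(b, a) :: q.edges).Perm (s(y, x) :: p.edges) := by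
    intro a b q hq hperm
    refine ⟨q.reverse, isHamiltonian_of_perm hq (by simp), ?_⟩
    rw [Sym2.eq_swap, Walk.edges_reverse]
    exact ((List.reverse_perm _).cons _).trans hperm
  have hself : (s(x, y) :: p.edges).Perm (s(y, x) :: p.edges) := by rw [Sym2.eq_swap]
  have dart_case : ∀ d ∈ p.darts, ∃ q : (⊤ : SimpleGraph V).Walk d.snd d.fst, q.IsHamiltonian ∧
      (s(d.snd, d.fst) :: q.edges).Perm (s(y, x) :: p.edges) := by
    intro d hd
    obtain ⟨q₁, q₂, rfl⟩ := exists_eq_append_of_mem_darts p hd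
    have hyx : (⊤ : SimpleGraph V).Adj y x := hxy.symm
    refine ⟨q₂.append (.cons hyx q₁), isHamiltonian_of_perm hp ?_, ?_⟩
    · simpa [Walk.support_append] using List.perm_append_comm
    · rw [Sym2.eq_swap (a := d.snd)]
      simp only [Walk.edges_append, Walk.edges_cons]
      rw [← Multiset.coe_eq_coe]
      simp only [← Multiset.cons_coe, ← Multiset.coe_add, ← Multiset.singleton_add]
      abel
  rw [Multiset.mem_cons, Multiset.mem_coe] at he
  rcases he with he | he
  · rw [Sym2.eq_iff] at he
    rcases he with ⟨rfl, rfl⟩ | ⟨rfl, rfl⟩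
    · exact reverse_case p hp hself
    · exact ⟨p, hp, hself⟩
  · obtain ⟨d, hd, hde⟩ := List.mem_map.1 he
    obtain ⟨q, hq, hperm⟩ := dart_case d hd
    have hde' : s(d.fst, d.snd) = s(a, b) := hde
    rw [Sym2.eq_iff] at hde'
    rcases hde' with ⟨rfl, rfl⟩ | ⟨rfl, rfl⟩
    · exact reverse_case q hq hperm
    · exact ⟨q, hq, hperm⟩

theorem exists_hamiltonian_top [Fintype V] [Nontrivial V] :
    ∃ (x y : V) (p : (⊤ : SimpleGraph V).Walk x y), p.IsHamiltonian ∧ x ≠ y := by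
  have hnd := (Finset.univ : Finset V).nodup_toList
  have hne : (Finset.univ : Finset V).toList ≠ [] := by
    simpa using Finset.univ_nonempty.ne_empty
  have hch : (Finset.univ : Finset V).toList.IsChain (⊤ : SimpleGraph V).Adj :=
    List.Pairwise.isChain (hnd.imp fun h ↦ h)
  have hp : (Walk.ofSupport _ hne hch).IsHamiltonian := by
    intro a
    rw [Walk.support_ofSupport]
    exact List.count_eq_one_of_mem hnd (by simp)
  refine ⟨_, _, _, hp, fun h ↦ ?_⟩
  have h1 := hp.length_eq
  have h2 := hp.isPath
  have h3 : 1 < Fintype.card V := Fintype.one_lt_card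
  -- Equal endpoints would make the path trivial, impossible with at least two vertices.
  generalize Walk.ofSupport _ hne hch = q at *
  revert q
  rw [← h]
  intro q _ h1 h2
  have h0 := Walk.length_eq_zero_iff.2 (Walk.isPath_iff_nil.1 h2)
  omega

end Walks

/-! ### Ore's condition and crossings -/

section Ore

variable {V ι : Type*}

/-- Ore's condition `σ₂(H) ≥ n`. -/
def IsOre (n : ℕ) (H : SimpleGraph V) : Prop :=
  ∀ u v, u ≠ v → ¬ H.Adj u v → n ≤ (H.neighborSet u).ncard + (H.neighborSet v).ncard

theorem IsOre.mono [Finite V] {n : ℕ} {H H' : SimpleGraph V} (h : IsOre n H) (hle : H ≤ H') :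
    IsOre n H' := by
  intro u v huv hadj
  refine (h u v huv fun h' ↦ hadj (hle h')).trans (add_le_add ?_ ?_) <;>
    exact Set.ncard_le_ncard (fun w hw ↦ hle hw) (Set.toFinite _)

theorem isOre_of_le_sigma2 [Fintype V] {n : ℕ} {H : SimpleGraph V} [DecidableRel H.Adj]
    (h : (n : ℕ∞) ≤ sigma2 H) : IsOre n H := by
  intro u v huv hadj
  have h' : (n : ℕ∞) ≤ ((H.degree u + H.degree v : ℕ) : ℕ∞) :=
    h.trans ((iInf₂_le u v).trans (iInf₂_le huv hadj))
  rw [Nat.cast_le] at h'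
  rwa [Set.ncard_eq_toFinset_card', Set.ncard_eq_toFinset_card', Set.toFinset_card,
    Set.toFinset_card, card_neighborSet_eq_degree, card_neighborSet_eq_degree]

variable [DecidableEq V]

/-- The family has a rainbow Hamiltonian cycle, presented as a Hamiltonian path from `x` to `y`
closed up by the edge `s(y, x)`. -/
def HasRainbowClosedPath (G : ι → SimpleGraph V) : Prop :=
  ∃ (x y : V) (p : (⊤ : SimpleGraph V).Walk x y), p.IsHamiltonian ∧ x ≠ y ∧
    IsRainbow G (s(y, x) ::ₘ (p.edges : Multiset (Sym2 V)))

theorem HasRainbowClosedPath.hasRainbowHamiltonianCycle [Fintype V] (hV : 3 ≤ Fintype.card V)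
    {G : ι → SimpleGraph V} (h : HasRainbowClosedPath G) : HasRainbowHamiltonianCycle G := by
  obtain ⟨x, y, p, hp, hxy, hc⟩ := h
  have hyx : (⊤ : SimpleGraph V).Adj y x := hxy.symm
  refine ⟨y, .cons hyx p, ⟨?_, ?_⟩, hc.containsRainbow ?_⟩
  · rw [Walk.cons_isCycle_iff]
    refine ⟨hp.isPath, fun hmem ↦ ?_⟩
    rw [Sym2.eq_swap] at hmem
    have h1 := hp.isPath.length_eq_one_of_mem_edges hmem
    have h2 := hp.length_eq
    omega
  · intro a
    simpa using hp a
  · intro e he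
    rw [Walk.mem_edges_toSubgraph, Walk.edges_cons] at he
    simpa using he

/-- Replacing the edge `d` of a Hamiltonian path from `w` to `y` by a crossing pair of edges at the
endpoints gives a Hamiltonian cycle. -/
theorem hasRainbowClosedPath_of_crossing {G : ι → SimpleGraph V} {w y x z : V}
    {Q : (⊤ : SimpleGraph V).Walk w y} (hQ : Q.IsHamiltonian) {M : Multiset (Sym2 V × ι)}
    {α β : ι} (hE : (Q.edges : Multiset (Sym2 V)) = s(x, z) ::ₘ M.map Prod.fst)
    (hnd : (α ::ₘ β ::ₘ M.map Prod.snd).Nodup) (hM : ∀ t ∈ M, t.1 ∈ (G t.2).edgeSet)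
    (hxz : ∀ i, (G i).Adj x z) {d : (⊤ : SimpleGraph V).Dart} (hd : d ∈ Q.darts)
    (hne : d.edge ≠ s(x, z)) (hα : (G α).Adj w d.snd) (hβ : (G β).Adj d.fst y) :
    HasRainbowClosedPath G := by
  have hdE : d.edge ∈ (Q.edges : Multiset (Sym2 V)) := List.mem_map_of_mem hd
  rw [hE, Multiset.mem_cons, or_iff_right hne, Multiset.mem_map] at hdE
  obtain ⟨⟨e, k⟩, hk, rfl⟩ := hdE
  obtain ⟨M, rfl⟩ := Multiset.exists_cons_of_mem hk
  obtain ⟨q₁, q₂, rfl⟩ := exists_eq_append_of_mem_darts Q hd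
  have hay : (⊤ : SimpleGraph V).Adj d.fst y := hβ.ne
  -- The cycle runs from `w` to `d.fst`, jumps to `y`, returns to `d.snd` and closes up. The color
  -- `k` freed by `d` goes to `s(x, z)`, which lies in every graph.
  refine ⟨w, d.snd, q₁.append (.cons hay q₂.reverse), isHamiltonian_of_perm hQ ?_, hα.ne,
    (s(d.snd, w), α) ::ₘ (s(d.fst, y), β) ::ₘ (s(x, z), k) ::ₘ M, ?_, ?_, ?_⟩
  · simpa [Walk.support_append] using (List.reverse_perm _).append_left _
  · have hE' : (q₁.edges : Multiset (Sym2 V)) + q₂.edges = s(x, z) ::ₘ M.map Prod.fst := by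
      simp only [Walk.edges_append, Walk.edges_cons, ← Multiset.coe_add, ← Multiset.cons_coe,
        Multiset.map_cons] at hE
      rw [Multiset.add_cons, Multiset.cons_swap (s(x, z))] at hE
      exact (Multiset.cons_inj_right _).1 hE
    simp only [Walk.edges_append, Walk.edges_cons, Walk.edges_reverse, ← Multiset.coe_add,
      ← Multiset.cons_coe, Multiset.map_cons, Multiset.coe_reverse, Multiset.add_cons, hE']
  · simpa only [Multiset.map_cons] using hnd
  · intro t ht
    simp only [Multiset.mem_cons] at ht
    rcases ht with rfl | rfl | rfl | ht
    · exact hα.symm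
    · exact hβ
    · exact hxz k
    · exact hM t (Multiset.mem_cons_of_mem ht)

/-- Counting the darts of a Hamiltonian path that start a crossing at its two endpoints. -/
theorem ncard_add_ncard_le [Fintype V] {w y : V} {Q : (⊤ : SimpleGraph V).Walk w y}
    (hQ : Q.IsHamiltonian) (K L : SimpleGraph V) :
    (K.neighborSet w).ncard + (L.neighborSet y).ncard + 1 ≤ Fintype.card V +
      {d | d ∈ Q.darts ∧ K.Adj w d.snd ∧ L.Adj d.fst y}.ncard := by
  set A : Set (⊤ : SimpleGraph V).Dart := {d | d ∈ Q.darts ∧ K.Adj w d.snd}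
  set B : Set (⊤ : SimpleGraph V).Dart := {d | d ∈ Q.darts ∧ L.Adj d.fst y}
  have hD : {d | d ∈ Q.darts}.Finite := Q.darts.finite_toSet
  have hAf : A.Finite := hD.subset fun d h ↦ h.1
  have hBf : B.Finite := hD.subset fun d h ↦ h.1
  have hA : (K.neighborSet w).ncard ≤ A.ncard := by
    refine (Set.ncard_le_ncard (t := (fun d ↦ d.snd) '' A) (fun v hv ↦ ?_)
      (hAf.image _)).trans (Set.ncard_image_le hAf)
    obtain ⟨d, hd, rfl⟩ := exists_dart_snd_eq Q (hQ.mem_support v) hv.ne'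
    exact ⟨d, ⟨hd, hv⟩, rfl⟩
  have hB : (L.neighborSet y).ncard ≤ B.ncard := by
    refine (Set.ncard_le_ncard (t := (fun d ↦ d.fst) '' B) (fun v hv ↦ ?_)
      (hBf.image _)).trans (Set.ncard_image_le hBf)
    obtain ⟨d, hd, rfl⟩ := exists_dart_fst_eq Q (hQ.mem_support v) hv.ne'
    exact ⟨d, ⟨hd, hv.symm⟩, rfl⟩
  -- There is one dart fewer than vertices, whence the `+ 1`.
  have hU : (A ∪ B).ncard + 1 ≤ Fintype.card V := by
    have h1 : (A ∪ B).ncard ≤ {d | d ∈ Q.darts}.ncard :=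
      Set.ncard_le_ncard (Set.union_subset (fun d h ↦ h.1) fun d h ↦ h.1) hD
    have h2 : {d | d ∈ Q.darts}.ncard ≤ Q.darts.length := by
      classical
      rw [← List.coe_toFinset, Set.ncard_coe_finset]
      exact Q.darts.toFinset_card_le
    have h3 := hQ.length_eq
    have h4 : 0 < Fintype.card V := Fintype.card_pos_iff.2 ⟨w⟩
    rw [Walk.length_darts] at h2
    omega
  have hI : {d | d ∈ Q.darts ∧ K.Adj w d.snd ∧ L.Adj d.fst y} = A ∩ B := by
    ext d
    simp only [A, B, Set.mem_ofPred_eq, Set.mem_inter_iff]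
    tauto
  have := Set.ncard_union_add_ncard_inter A B hAf hBf
  rw [hI]
  omega

/-- If `s(x, z)` is an edge of every graph of an Ore family and a rainbow Hamiltonian path from `x`
to `y` misses a color `i` in which `x` and `y` are not adjacent, then there is a rainbow Hamiltonian
cycle. -/
theorem hasRainbowClosedPath_of_path [Fintype V] {G : ι → SimpleGraph V}
    (hG : ∀ i, IsOre (Fintype.card V) (G i)) {x y z : V} {i : ι} (hxy : ¬ (G i).Adj x y)
    (hxz : ∀ j, (G j).Adj x z) {q : (⊤ : SimpleGraph V).Walk x y} (hq : q.IsHamiltonian)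
    {M : Multiset (Sym2 V × ι)} (hE : M.map Prod.fst = (q.edges : Multiset (Sym2 V)))
    (hnd : (i ::ₘ M.map Prod.snd).Nodup) (hM : ∀ t ∈ M, t.1 ∈ (G t.2).edgeSet) :
    HasRainbowClosedPath G := by
  by_contra hno
  obtain ⟨d, hd, rfl⟩ := exists_dart_snd_eq q (hq.mem_support z) (hxz i).ne'
  have hdE : d.edge ∈ (q.edges : Multiset (Sym2 V)) := List.mem_map_of_mem hd
  rw [← hE, Multiset.mem_map] at hdE
  obtain ⟨⟨e, k⟩, hk, hek⟩ := hdE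
  obtain ⟨M, rfl⟩ := Multiset.exists_cons_of_mem hk
  obtain ⟨q₁, q₂, rfl⟩ := exists_eq_append_of_mem_darts q hd
  have hxz' : (⊤ : SimpleGraph V).Adj x d.snd := (hxz i).ne
  -- Rotation: the dart entering `z` is replaced by `s(x, z)`, which frees its color `k` beside `i`.
  set Q : (⊤ : SimpleGraph V).Walk d.fst y := q₁.reverse.append (.cons hxz' q₂) with hQdef
  have hQ : Q.IsHamiltonian := by
    refine isHamiltonian_of_perm hq ?_
    simpa [hQdef, Walk.support_append] using (List.reverse_perm _).append_right _
  have hQE : (Q.edges : Multiset (Sym2 V)) = s(x, d.snd) ::ₘ M.map Prod.fst := by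
    have hek' : e = s(d.fst, d.snd) := hek
    simp only [Walk.edges_append, Walk.edges_cons, ← Multiset.coe_add, ← Multiset.cons_coe,
      Multiset.map_cons, Multiset.add_cons, hek'] at hE
    simp only [hQdef, Walk.edges_append, Walk.edges_cons, Walk.edges_reverse, ← Multiset.coe_add,
      ← Multiset.cons_coe, Multiset.coe_reverse, Multiset.add_cons,
      (Multiset.cons_inj_right _).1 hE]
  have hnd₁ : (i ::ₘ k ::ₘ M.map Prod.snd).Nodup := by simpa only [Multiset.map_cons] using hnd
  have hnd₂ : (k ::ₘ i ::ₘ M.map Prod.snd).Nodup := by rwa [Multiset.cons_swap]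
  have hM' : ∀ t ∈ M, t.1 ∈ (G t.2).edgeSet := fun t ht ↦ hM t (Multiset.mem_cons_of_mem ht)
  have hwy : d.fst ≠ y := by
    rintro h
    have := hq.isPath.support_nodup
    rw [Walk.support_append, Walk.support_cons, List.tail_cons] at this
    exact List.disjoint_of_nodup_append this q₁.end_mem_support (h ▸ q₂.end_mem_support)
  -- Either spare color closes up `Q`, the other one being used for `s(x, d.snd)`.
  have hnonadj : ∀ a b, (a ::ₘ b ::ₘ M.map Prod.snd).Nodup → ¬ (G a).Adj d.fst y := by
    intro a b hab hadj
    refine hno ⟨d.fst, y, Q, hQ, hwy, (s(y, d.fst), a) ::ₘ (s(x, d.snd), b) ::ₘ M, ?_, ?_, ?_⟩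
    · rw [Multiset.map_cons, Multiset.map_cons, hQE]
    · simpa only [Multiset.map_cons] using hab
    · intro t ht
      simp only [Multiset.mem_cons] at ht
      rcases ht with rfl | rfl | ht
      · exact hadj.symm
      · exact hxz b
      · exact hM' t ht
  -- The only crossing not handled by the crossing lemma is at the edge `s(x, z)` itself, and it
  -- requires `x` and `y` adjacent in color `b`; for `b = i` this is excluded.
  have hcross : ∀ a b, (a ::ₘ b ::ₘ M.map Prod.snd).Nodup →
      {d' | d' ∈ Q.darts ∧ (G a).Adj d.fst d'.snd ∧ (G b).Adj d'.fst y} ⊆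
        {d' | d' = ⟨(x, d.snd), hxz'⟩ ∧ (G b).Adj x y} := by
    rintro a b hab d' ⟨hd', ha, hb⟩
    have hedge : d'.edge = s(x, d.snd) := by
      by_contra hne
      exact hno (hasRainbowClosedPath_of_crossing hQ hQE hab hM' hxz hd' hne ha hb)
    have heq : d' = ⟨(x, d.snd), hxz'⟩ := by
      refine List.inj_on_of_nodup_map (f := Dart.edge) hQ.isPath.isTrail.edges_nodup hd' ?_ hedge
      simp [hQdef]
    exact ⟨heq, by rw [heq] at hb; exact hb⟩
  have h₁ : {d' | d' ∈ Q.darts ∧ (G i).Adj d.fst d'.snd ∧ (G k).Adj d'.fst y}.ncard ≤ 1 := by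
    refine (Set.ncard_le_ncard (t := {⟨(x, d.snd), hxz'⟩}) (fun d' h ↦ ?_)).trans
      (Set.ncard_singleton _).le
    exact (hcross i k hnd₁ h).1
  have h₂ : {d' | d' ∈ Q.darts ∧ (G k).Adj d.fst d'.snd ∧ (G i).Adj d'.fst y}.ncard = 0 := by
    rw [Set.eq_empty_of_forall_notMem fun d' h ↦ hxy (hcross k i hnd₂ h).2, Set.ncard_empty]
  have h₃ := ncard_add_ncard_le hQ (G i) (G k)
  have h₄ := ncard_add_ncard_le hQ (G k) (G i)
  have h₅ := hG i _ _ hwy (hnonadj i k hnd₁)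
  have h₆ := hG k _ _ hwy (hnonadj k i hnd₂)
  -- Summing both counts gives 2n + 2 ≤ 2n + 1.
  omega

/-- Induction from larger families to smaller ones. Complete graphs are the base case; multisets let
the two-vertex case use its edge twice. -/
theorem hasRainbowClosedPath_of_common_edge [Fintype V] {n : ℕ} (hV : Fintype.card V = n)
    (G : Fin n → SimpleGraph V) (hG : ∀ i, IsOre n (G i)) {u v : V} (huv : ∀ i, (G i).Adj u v) :
    HasRainbowClosedPath G := by
  classical
  induction G using WellFoundedGT.induction with
  | ind G ih =>
  have : Nonempty (Fin n) := ⟨⟨0, hV ▸ Fintype.card_pos_iff.2 ⟨u⟩⟩⟩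
  have : Nontrivial V := ⟨u, v, (huv (Classical.arbitrary _)).ne⟩
  by_cases hcomplete : ∀ i x y, x ≠ y → (G i).Adj x y
  · obtain ⟨x, y, p, hp, hxy⟩ := exists_hamiltonian_top (V := V)
    refine ⟨x, y, p, hp, hxy, ?_⟩
    rw [Multiset.cons_coe]
    refine isRainbow_of_forall_adj hcomplete ?_ ?_
    · have := hp.length_eq
      have := Fintype.card_pos (α := V)
      rw [List.length_cons, Walk.length_edges]
      omega
    · intro e he
      rw [List.mem_cons] at he
      rcases he with rfl | he
      · simpa using hxy.symm
      · exact SimpleGraph.not_isDiag_of_mem_edgeSet _ (p.edges_subset_edgeSet he)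
  -- If `u` is adjacent to everything in every graph, any missing pair `x`, `y` works, with common
  -- edge `s(x, u)`.
  obtain ⟨i, x, y, hxy, hadj, z, hxz⟩ :
      ∃ i x y, x ≠ y ∧ ¬ (G i).Adj x y ∧ ∃ z, ∀ j, (G j).Adj x z := by
    by_cases hu : ∃ i y, u ≠ y ∧ ¬ (G i).Adj u y
    · obtain ⟨i, y, huy, hadj⟩ := hu
      exact ⟨i, u, y, huy, hadj, v, huv⟩
    · push Not at hu hcomplete
      obtain ⟨i, x, y, hxy, hadj⟩ := hcomplete
      refine ⟨i, x, y, hxy, hadj, u, fun j ↦ (hu j x ?_).symm⟩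
      rintro rfl
      exact hadj (hu i y hxy)
  set G' : Fin n → SimpleGraph V := Function.update G i (G i ⊔ edge x y) with hG'
  have hle : G ≤ G' := by
    rw [hG', le_update_iff]
    exact ⟨le_sup_left, fun _ _ ↦ le_rfl⟩
  have hlt : G < G' := by
    refine lt_of_le_of_ne hle fun h ↦ hadj ?_
    rw [congrFun h i, hG', Function.update_self]
    exact Or.inr (by simp [edge_adj, hxy])
  have hback : ∀ e j, e ∈ (G' j).edgeSet → e ∉ (G j).edgeSet → j = i ∧ e = s(x, y) := by
    intro e j he he'
    by_cases hj : j = i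
    · subst hj
      refine ⟨rfl, ?_⟩
      rw [hG', Function.update_self, edgeSet_sup, edgeSet_edge_of_ne hxy] at he
      exact he.resolve_left he'
    · rw [hG', Function.update_of_ne hj] at he
      exact absurd he he'
  obtain ⟨a, b, p, hp, hab, M, hE, hnd, hM⟩ :=
    ih G' hlt (fun j ↦ (hG j).mono (hle j)) fun j ↦ hle j (huv j)
  by_cases hall : ∀ t ∈ M, t.1 ∈ (G t.2).edgeSet
  · exact ⟨a, b, p, hp, hab, M, hE, hnd, hall⟩
  push Not at hall
  obtain ⟨⟨e, j⟩, ht, hte⟩ := hall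
  obtain ⟨rfl, rfl⟩ := hback e j (hM _ ht) hte
  obtain ⟨M, rfl⟩ := Multiset.exists_cons_of_mem ht
  rw [Multiset.map_cons] at hE hnd
  obtain ⟨q, hq, hqE⟩ := exists_hamiltonian_reopen hp hab
    (hE ▸ Multiset.mem_cons_self s(x, y) (M.map Prod.fst))
  refine hasRainbowClosedPath_of_path (by rwa [hV]) hadj hxz hq
    ((Multiset.cons_inj_right _).1 (hE.trans hqE.symm)) hnd fun t ht' ↦ ?_
  -- Another new edge would repeat color `j`.
  by_contra hte'
  obtain ⟨h, -⟩ := hback t.1 t.2 (hM t (Multiset.mem_cons_of_mem ht')) hte'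
  exact (Multiset.nodup_cons.1 hnd).1 (Multiset.mem_map.2 ⟨t, ht', h⟩)

/-- Two non-adjacent vertices that make up the whole graph have degree 0. -/
theorem adj_of_isOre_of_card_le_two [Fintype V] {H : SimpleGraph V} (hV : Fintype.card V ≤ 2)
    (hH : IsOre (Fintype.card V) H) {u v : V} (huv : u ≠ v) : H.Adj u v := by
  by_contra hadj
  have h2 : ∀ w : V, w = u ∨ w = v := by
    intro w
    by_contra! hw
    have : ({w, u, v} : Finset V).card ≤ 2 := (Finset.card_le_univ _).trans hV
    rw [Finset.card_eq_three.2 ⟨w, u, v, hw.1, hw.2, huv, rfl⟩] at this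
    omega
  have hu : H.neighborSet u = ∅ := by
    refine Set.eq_empty_of_forall_notMem fun w hw ↦ ?_
    rcases h2 w with rfl | rfl
    · exact H.irrefl hw
    · exact hadj hw
  have hv : H.neighborSet v = ∅ := by
    refine Set.eq_empty_of_forall_notMem fun w hw ↦ ?_
    rcases h2 w with rfl | rfl
    · exact hadj hw.symm
    · exact H.irrefl hw
  have h0 := hH u v huv hadj
  rw [hu, hv, Set.ncard_empty] at h0
  have : 0 < Fintype.card V := Fintype.card_pos_iff.2 ⟨u⟩
  omega

theorem hasRainbowHamiltonianPath_of_card_le_two [Fintype V] [Nonempty ι] {G : ι → SimpleGraph V}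
    (hV : Fintype.card V ≤ 2) (hG : ∀ i, IsOre (Fintype.card V) (G i)) {u v : V} (huv : u ≠ v) :
    HasRainbowHamiltonianPath G u v := by
  have hadj : (⊤ : SimpleGraph V).Adj u v := huv
  let i : ι := Classical.arbitrary ι
  have hr : IsRainbow G {s(u, v)} :=
    ⟨{(s(u, v), i)}, by simp, by simp,
      by simpa using adj_of_isOre_of_card_le_two hV (hG i) huv⟩
  have h1 : 1 < Fintype.card V := Fintype.one_lt_card_iff.2 ⟨u, v, huv⟩
  refine ⟨hadj.toWalk, ?_, hr.containsRainbow fun e he ↦ ?_⟩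
  · rw [Walk.isHamiltonian_iff_isPath_and_length_eq]
    refine ⟨by simp [huv], ?_⟩
    rw [Walk.length_cons, Walk.length_nil]
    omega
  · rw [Walk.mem_edges_toSubgraph] at he
    simpa using he

/-- In an Ore family without rainbow Hamiltonian cycle, any two vertices are joined by a rainbow
Hamiltonian path: add the edge between them to every graph of the family. -/
theorem hasRainbowHamiltonianPath_of_not_closedPath [Fintype V] {n : ℕ}
    (hV : Fintype.card V = n) (hn : 3 ≤ n) {G : Fin n → SimpleGraph V}
    (hG : ∀ i, IsOre n (G i)) (hno : ¬ HasRainbowClosedPath G) {u v : V} (huv : u ≠ v) :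
    HasRainbowHamiltonianPath G u v := by
  obtain ⟨a, b, p, hp, hab, M, hE, hnd, hM⟩ := hasRainbowClosedPath_of_common_edge hV
    (fun i ↦ G i ⊔ edge u v) (fun i ↦ (hG i).mono le_sup_left) (u := u) (v := v)
    (fun i ↦ Or.inr (by simp [edge_adj, huv]))
  have hback : ∀ t ∈ M, t.1 ≠ s(u, v) → t.1 ∈ (G t.2).edgeSet := by
    intro t ht hne
    have := hM t ht
    rw [edgeSet_sup, edgeSet_edge_of_ne huv] at this
    exact this.resolve_right hne
  by_cases hmem : s(u, v) ∈ M.map Prod.fst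
  · obtain ⟨q, hq, hqE⟩ := exists_hamiltonian_reopen hp hab (hE ▸ hmem)
    obtain ⟨⟨e, i⟩, ht, hte⟩ := Multiset.mem_map.1 hmem
    obtain ⟨M, rfl⟩ := Multiset.exists_cons_of_mem ht
    obtain rfl : e = s(u, v) := hte
    rw [Multiset.map_cons] at hE hnd
    have hME := (Multiset.cons_inj_right _).1 (hE.trans hqE.symm)
    have hr : IsRainbow G (q.edges : Multiset (Sym2 V)) := by
      refine ⟨M, hME, (Multiset.nodup_cons.1 hnd).2, fun t ht' ↦
        hback t (Multiset.mem_cons_of_mem ht') fun h ↦ ?_⟩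
      have hmem' : s(u, v) ∈ (q.edges : Multiset (Sym2 V)) := by
        rw [← hME, ← h]
        exact Multiset.mem_map_of_mem _ ht'
      -- A path containing the edge between its endpoints has length 1, but here the length is n - 1
      -- ≥ 2.
      have h1 := hq.isPath.length_eq_one_of_mem_edges hmem'
      have h2 := hq.length_eq
      omega
    exact ⟨q, hq, hr.containsRainbow fun e he ↦ by simpa using he⟩
  · refine absurd ⟨a, b, p, hp, hab, M, hE, hnd, fun t ht ↦ hback t ht fun h ↦ hmem ?_⟩ hno
    rw [← h]
    exact Multiset.mem_map_of_mem _ ht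

end Ore

end RainbowHam

theorem corollary1p5 {V : Type*} [Fintype V] [DecidableEq V] (n : ℕ)
    (hV : Fintype.card V = n) (G : Fin n → SimpleGraph V) [∀ i, DecidableRel (G i).Adj]
    (hG : ∀ i, (n : ℕ∞) ≤ RainbowHam.sigma2 (G i)) :
    RainbowHam.HasRainbowHamiltonianCycle G ∨ RainbowHam.RainbowHamiltonianConnected G := by
  have hO : ∀ i, RainbowHam.IsOre n (G i) := fun i ↦ RainbowHam.isOre_of_le_sigma2 (hG i)
  by_cases hn : 3 ≤ n
  · by_cases h : RainbowHam.HasRainbowClosedPath G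
    · exact Or.inl (h.hasRainbowHamiltonianCycle (hV ▸ hn))
    · exact Or.inr fun u v huv ↦
        RainbowHam.hasRainbowHamiltonianPath_of_not_closedPath hV hn hO h huv
  -- With fewer than three vertices no cycle exists, so the second alternative must hold.
  · refine Or.inr fun u v huv ↦ ?_
    have : Nonempty (Fin n) := ⟨⟨0, hV ▸ Fintype.card_pos_iff.2 ⟨u⟩⟩⟩
    exact RainbowHam.hasRainbowHamiltonianPath_of_card_le_two (by omega) (by rwa [hV]) huv
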